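/- Let $G=(V,E)$ be a finite simple graph with $n$ vertices, bipartite with respect to a partition $V=W\sqcup B$ (every edge joins $W$ and $B$), and let $k\ge 0$ be an integer. Let $|G\rangle=\big(\prod_{e\in E}CZ_e\big)|+\rangle^{\otimes n}$ be its graph state, which is stabilized by $X_j\prod_{i\in N(j)}Z_i$ for all $j\in V$, where $N(j)$ is the set of neighbours of $j$. Bob sends an arbitrary state (density matrix) $\rho$ of $n(2k+1)$ qubits, arranged in $2k+1$ blocks of $n$ qubits. Alice divides the blocks, uniformly at random, into a first group of $k$ blocks, a second group of $k$ blocks and a third group of one block. In each block of the first group she measures the qubits of $W$ in the $Z$ basis and those of $B$ in the $X$ basis; in each block of the second group she measures the qubits of $B$ in the $Z$ basis and those of $W$ in the $X$ basis. The test is passed if in every measured block the outcome bit $x_j$ of each qubit $j$ measured in the $X$ basis equals the predicted value $\sum_{i\in N(j)}z_i \bmod 2$, where the $z_i$ are the outcome bits of the $Z$ measurements. Let $p(\rho)$ be the probability that the test is passed (over the random division and the measurement outcomes) and, if $p(\rho)>0$, let $\sigma=\sigma(\rho)$ be the state of the third group conditioned on the test being passed (averaged over the division and the outcomes). For $f\in\mathbb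 R$, the significance level of the assertion "$\langle G|\sigma|G\rangle\ge f$" is the supremum of $p(\rho)$ over all $\rho$ with $p(\rho)>0$ for which $\langle G|\sigma(\rho)|G\rangle<f$ (and $0$ if there is no such $\rho$). 1. For every real $\alpha>\frac1{2k+1}$, the assertion $$\langle G|\sigma|G\rangle\ \ge\ 1-\frac{1}{\alpha(2k+1)}$$ has significance level at most $\alpha$; moreover, every $\rho$ with $p(\rho)\ge\alpha$ satisfies this inequality. 2. The lower bound $\frac1{2k+1}$ on $\alpha$ is tight: if $W$ and $B$ are both nonempty, there is an $n$-qubit unit vector $|\psi\rangle$ such that, if Bob sends $2k$ copies of $|G\rangle$ and one copy of $|\psi\rangle$ (in any position), then $p(\rho)=\frac1{2k+1}$ and $\langle G|\sigma|G\rangle=0$. In particular, for every $f>0$ the assertion "$\langle G|\sigma|G\rangle\ge f$" has significance level at least $\frac1{2k+1}$. -/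

import Mathlib

open scoped Matrix ComplexOrder

noncomputable section

namespace GraphStateTest

/-- Computational basis labels of a register with one qubit per element of `V`. -/
abbrev Bits (V : Type*) := V → ZMod 2

/-- Computational basis labels of `2k+1` blocks, each with one qubit per element of `V`. -/
abbrev Blocks (V : Type*) (k : ℕ) := Fin (2 * k + 1) → Bits V

/-- Density matrix. -/
def IsDensity {ι : Type*} [Fintype ι] (ρ : Matrix ι ι ℂ) : Prop :=
  ρ.PosSemidef ∧ ρ.trace = 1

/-- The projector `|ψ⟩⟨ψ|`. -/
def pureState {ι : Type*} (ψ : ι → ℂ) : Matrix ι ι ℂ := Matrix.vecMulVec ψ (star ψ)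

/-- The `Z`-basis vector `|b⟩`. -/
def zKet (b : ZMod 2) : ZMod 2 → ℂ := fun a => if a = b then 1 else 0

/-- The `X`-basis vector `(|0⟩ + (-1)^b |1⟩)/√2`. -/
def xKet (b : ZMod 2) : ZMod 2 → ℂ :=
  fun a => (if a = 1 ∧ b = 1 then -1 else 1) / (Real.sqrt 2 : ℂ)

section Graph

variable {V : Type*} [Fintype V] [DecidableEq V]

/-- The controlled-`Z` gate on the two qubits of `e`: it flips the sign of exactly those
computational basis states in which both qubits are `1`. -/
def cz (e : Sym2 V) : Matrix (Bits V) (Bits V) ℂ :=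
  Matrix.diagonal fun z => if ∀ v ∈ e, z v = 1 then -1 else 1

/-- The state `|+⟩` on every qubit. -/
def plusState : Bits V → ℂ := fun z => ∏ v, xKet 0 (z v)

/-- The graph state `(∏_{e ∈ E} CZ_e) |+⟩^{⊗ V}`. -/
def graphState (G : SimpleGraph V) [DecidableRel G.Adj] : Bits V → ℂ :=
  (G.edgeFinset.noncommProd cz fun _ _ _ _ _ => Matrix.commute_diagonal _ _) *ᵥ plusState

/-- The product vector of the outcome `o` when the qubits in `S` are measured in the `X` basis
and all other qubits in the `Z` basis. -/
def outcomeKet (S : Finset V) (o : Bits V) : Bits V → ℂ :=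
  fun z => ∏ v, if v ∈ S then xKet (o v) (z v) else zKet (o v) (z v)

/-- The `X` outcomes on `S` agree with the values predicted from the `Z` outcomes by the
stabilizers `X_j ⊗ ∏_{i ∈ N(j)} Z_i`, `j ∈ S`. -/
def Consistent (G : SimpleGraph V) [DecidableRel G.Adj] (S : Finset V) (o : Bits V) : Prop :=
  ∀ j ∈ S, o j = ∑ i ∈ G.neighborFinset j, o i

/-- `⟨G|σ|G⟩`. -/
def fidelity (G : SimpleGraph V) [DecidableRel G.Adj] (σ : Matrix (Bits V) (Bits V) ℂ) : ℝ :=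
  (star (graphState G) ⬝ᵥ (σ *ᵥ graphState G)).re

/-- All ways to divide the `2k+1` blocks into a first group of `k` blocks, a second group of `k`
blocks and a single third block. -/
def divisions (k : ℕ) :
    Finset (Finset (Fin (2 * k + 1)) × Finset (Fin (2 * k + 1)) × Fin (2 * k + 1)) :=
  Finset.univ.filter fun d =>
    d.1.card = k ∧ d.2.1.card = k ∧ Disjoint d.1 d.2.1 ∧ d.2.2 ∉ d.1 ∧ d.2.2 ∉ d.2.1

/-- The qubits measured in the `X` basis in block `i`: those of `B` if the block is in the first
group, those of `W` if it is in the second group. -/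
def xSites {k : ℕ} (W B : Finset V) (first : Finset (Fin (2 * k + 1))) (i : Fin (2 * k + 1)) :
    Finset V :=
  if i ∈ first then B else W

/-- The operator `(⨂_{i ≠ third} ⟨o_i|) ⊗ 1_third` belonging to the measurement outcomes `o` on
all blocks other than the third group. -/
def outcomeOp {k : ℕ} (W B : Finset V) (first : Finset (Fin (2 * k + 1)))
    (third : Fin (2 * k + 1)) (o : {i // i ≠ third} → Bits V) :
    Matrix (Bits V) (Blocks V k) ℂ :=
  Matrix.of fun a w =>
    if w third = a then ∏ i : {i // i ≠ third}, star (outcomeKet (xSites W B first i) (o i) (w i))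
    else 0

open Classical in
/-- Unnormalized state of the third group when the test is passed: the average over the uniformly
random division of the sum, over all outcomes that pass the test, of the unnormalized
post-measurement states. -/
def passedState (G : SimpleGraph V) [DecidableRel G.Adj] (W B : Finset V) {k : ℕ}
    (ρ : Matrix (Blocks V k) (Blocks V k) ℂ) : Matrix (Bits V) (Bits V) ℂ :=
  ((divisions k).card : ℂ)⁻¹ • ∑ d ∈ divisions k,
    ∑ o : {i // i ≠ d.2.2} → Bits V with
        ∀ i : {i // i ≠ d.2.2}, Consistent G (xSites W B d.1 i) (o i),
      outcomeOp W B d.1 d.2.2 o * ρ * (outcomeOp W B d.1 d.2.2 o)ᴴ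

/-- The probability that the test is passed. -/
def passProb (G : SimpleGraph V) [DecidableRel G.Adj] (W B : Finset V) {k : ℕ}
    (ρ : Matrix (Blocks V k) (Blocks V k) ℂ) : ℝ :=
  (passedState G W B ρ).trace.re

/-- The state `σ` of the third group conditioned on the test being passed
(meaningful when `passProb` is positive). -/
def resultState (G : SimpleGraph V) [DecidableRel G.Adj] (W B : Finset V) {k : ℕ}
    (ρ : Matrix (Blocks V k) (Blocks V k) ℂ) : Matrix (Bits V) (Bits V) ℂ :=
  ((passProb G W B ρ : ℂ))⁻¹ • passedState G W B ρ

/-- The significance level of the assertion `⟨G|σ|G⟩ ≥ f`: the supremum of the passing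
probabilities over all states whose resulting third-group state violates the assertion. -/
def significanceLevel (G : SimpleGraph V) [DecidableRel G.Adj] (W B : Finset V) (k : ℕ)
    (f : ℝ) : ℝ :=
  sSup {p : ℝ | ∃ ρ : Matrix (Blocks V k) (Blocks V k) ℂ, IsDensity ρ ∧
    p = passProb G W B ρ ∧ 0 < p ∧ fidelity G (resultState G W B ρ) < f}

/-- The product vector with `ψ` in block `i` and the graph state in the other `2k` blocks. -/
def oneWrong (G : SimpleGraph V) [DecidableRel G.Adj] {k : ℕ} (ψ : Bits V → ℂ)
    (i : Fin (2 * k + 1)) : Blocks V k → ℂ :=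
  fun w => ∏ j, if j = i then ψ (w j) else graphState G (w j)

end Graph

end GraphStateTest

end

/-!
For the test, a state `ρ` of the blocks matters only through the distribution of the labels
`s i` found when every block `i` is measured in the graph basis `(∏_j Z_j^{s j}) |G⟩`. Indeed, let
the set `S` of sites measured in the `X` basis be independent. Up to a sign, the product vector of
a passing outcome is the image under the controlled-`Z` gates of `|+⟩` on `S` and a `Z`-basis vector
elsewhere, because the gates at `S` turn each `|+⟩` into the predicted `X`-basis vector. With an
`X`-basis vector elsewhere one gets the graph basis vectors whose label vanishes on `S` instead, so
both families span the same space. Thus the test is passed exactly if the labels vanish on `B` in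
the first group and on `W` in the second one, and it is fooled if moreover the label of the third
block is not zero.

For fixed labels at most a fraction `1 / (2k + 1)` of the divisions is fooled. Place the blocks on a
cycle and let each block `p` be the third one, the groups being the `k` blocks after it and the `k`
blocks before it; the blocks after `p` form the first group if the label of `p` does not vanish on
`B`, and the second group otherwise. If `q` is after `p`, then `p` is before `q`, and one of the two
divisions detects the third block of the other; hence at most one of the `2k + 1` divisions is
fooled, and averaging over all arrangements on the cycle gives the bound. Dividing by `p(ρ) ≥ α`
turns it into a bound on the infidelity. If the label is nonzero on both `W` and `B` in a single
block, the test is passed exactly when this block is the third one.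
-/

noncomputable section

namespace GraphStateTest

section OrbitSum

open MulAction

variable {Γ X : Type*} [Group Γ] [MulAction Γ X]

theorem card_nsmul_sum_smul_eq {M : Type*} [AddCommMonoid M] [Fintype Γ] {s : Finset X}
    {x : X} (hs : (s : Set X) = orbit Γ x) (f : X → M) :
    s.card • ∑ g : Γ, f (g • x) = Fintype.card Γ • ∑ y ∈ s, f y := by
  have mem_iff (y : X) : y ∈ s ↔ y ∈ orbit Γ x := by rw [← Finset.mem_coe, hs]
  have sum_group_eq : ∀ y ∈ s, ∑ g : Γ, f (g • y) = ∑ g : Γ, f (g • x) := by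
    intro y hy
    obtain ⟨h, rfl⟩ := (mem_iff y).1 hy
    exact Fintype.sum_equiv (Equiv.mulRight h) _ _ fun g => by simp [mul_smul]
  have sum_orbit_eq (g : Γ) : ∑ y ∈ s, f (g • y) = ∑ y ∈ s, f y :=
    Finset.sum_equiv (toPerm g) (fun y => by simp [mem_iff, ← orbit_eq_iff]) fun _ _ => rfl
  calc s.card • ∑ g : Γ, f (g • x) = ∑ y ∈ s, ∑ g : Γ, f (g • y) := by
        rw [Finset.sum_congr rfl sum_group_eq, Finset.sum_const]
    _ = ∑ g : Γ, ∑ y ∈ s, f (g • y) := Finset.sum_comm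
    _ = Fintype.card Γ • ∑ y ∈ s, f y := by simp [sum_orbit_eq]

/-- Katona's cycle method. -/
theorem card_mul_card_filter_le_of_orbit {ι : Type*} [Finite Γ] [Fintype ι]
    {s : Finset X} {x : ι → X} (hs : ∀ i, (s : Set X) = orbit Γ (x i))
    (p : X → Prop) [DecidablePred p] (hp : ∀ g : Γ, {i | p (g • x i)}.Subsingleton) :
    Fintype.card ι * {y ∈ s | p y}.card ≤ s.card := by
  cases nonempty_fintype Γ
  have card_le_one (g : Γ) : ∑ i, (if p (g • x i) then 1 else 0) ≤ 1 := by
    rw [← Finset.card_filter, Finset.card_le_one_iff_subsingleton]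
    simpa [Set.Subsingleton] using hp g
  refine Nat.le_of_mul_le_mul_left ?_ (Fintype.card_pos (α := Γ))
  calc Fintype.card Γ * (Fintype.card ι * {y ∈ s | p y}.card)
      = ∑ _i : ι, Fintype.card Γ • ∑ y ∈ s, if p y then 1 else 0 := by
        rw [Finset.card_filter, Finset.sum_const, smul_eq_mul, smul_eq_mul, Finset.card_univ,
          mul_left_comm]
    _ = ∑ i, s.card • ∑ g : Γ, (if p (g • x i) then 1 else 0) :=
        Finset.sum_congr rfl fun i _ => (card_nsmul_sum_smul_eq (hs i) _).symm
    _ = s.card * ∑ g : Γ, ∑ i, (if p (g • x i) then 1 else 0) := by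
        rw [← Finset.smul_sum, Finset.sum_comm, smul_eq_mul]
    _ ≤ s.card * ∑ _g : Γ, 1 := by gcongr with g; exact card_le_one g
    _ = Fintype.card Γ * s.card := by simp [mul_comm]

end OrbitSum

section Divisions

open scoped Pointwise

variable {k : ℕ}

/-- The type of triples (first group, second group, third block) that contains `divisions k`;
permutations of the blocks act on it. -/
abbrev Division (k : ℕ) :=
  Finset (Fin (2 * k + 1)) × Finset (Fin (2 * k + 1)) × Fin (2 * k + 1)

theorem mem_divisions {d : Division k} : d ∈ divisions k ↔
    d.1.card = k ∧ d.2.1.card = k ∧ Disjoint d.1 d.2.1 ∧ d.2.2 ∉ d.1 ∧ d.2.2 ∉ d.2.1 := by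
  simp [divisions]

theorem smul_mem_divisions (π : Equiv.Perm (Fin (2 * k + 1))) {d : Division k}
    (hd : d ∈ divisions k) : π • d ∈ divisions k := by
  rw [mem_divisions] at hd ⊢
  simp only [Prod.smul_fst, Prod.smul_snd, Finset.card_smul_finset,
    Finset.smul_mem_smul_finset_iff]
  refine ⟨hd.1, hd.2.1, ?_, hd.2.2.2⟩
  rw [← Finset.disjoint_coe, Finset.coe_smul_finset, Finset.coe_smul_finset]
  exact Set.disjoint_smul_set.2 (Finset.disjoint_coe.2 hd.2.2.1)

theorem notMem_groups_iff_eq_third {d : Division k} (hd : d ∈ divisions k) {i : Fin (2 * k + 1)} :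
    i ∉ d.1 ∧ i ∉ d.2.1 ↔ i = d.2.2 := by
  obtain ⟨card_first, card_second, hdisj, third_notMem⟩ := mem_divisions.1 hd
  have hcompl : (d.1 ∪ d.2.1)ᶜ.card = 1 := by
    rw [Finset.card_compl, Finset.card_union_of_disjoint hdisj, Fintype.card_fin]
    lia
  obtain ⟨j, hj⟩ := Finset.card_eq_one.1 hcompl
  have mem_iff (i : Fin (2 * k + 1)) : i ∉ d.1 ∧ i ∉ d.2.1 ↔ i = j := by
    rw [← Finset.mem_singleton, ← hj]; simp
  rw [(mem_iff _).1 third_notMem, mem_iff]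

/-- The number of the group to which `d` assigns the block `i`, with `2` for the third group. -/
def groupOf (d : Division k) (i : Fin (2 * k + 1)) : Fin 3 :=
  if i ∈ d.1 then 0 else if i ∈ d.2.1 then 1 else 2

theorem groupOf_eq_zero_iff {d : Division k} {i : Fin (2 * k + 1)} :
    groupOf d i = 0 ↔ i ∈ d.1 := by
  grind [groupOf]

theorem groupOf_eq_one_iff {d : Division k} (hd : d ∈ divisions k) {i : Fin (2 * k + 1)} :
    groupOf d i = 1 ↔ i ∈ d.2.1 := by
  have hdisj : i ∈ d.1 → i ∉ d.2.1 := fun hi => Finset.disjoint_left.1 (mem_divisions.1 hd).2.2.1 hi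
  unfold groupOf
  split_ifs <;> simp_all

theorem groupOf_eq_two_iff {d : Division k} (hd : d ∈ divisions k) {i : Fin (2 * k + 1)} :
    groupOf d i = 2 ↔ i = d.2.2 := by
  rw [← notMem_groups_iff_eq_third hd]
  grind [groupOf]

theorem card_groupOf_fiber {d : Division k} (hd : d ∈ divisions k) (c : Fin 3) :
    Fintype.card {i // groupOf d i = c} = if c = 2 then 1 else k := by
  obtain ⟨card_first, card_second, -⟩ := mem_divisions.1 hd
  rw [Fintype.card_subtype]
  fin_cases c
  · simpa [groupOf_eq_zero_iff] using card_first
  · simpa [groupOf_eq_one_iff hd] using card_second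
  · simp [groupOf_eq_two_iff hd, Finset.filter_eq']

theorem exists_perm_smul_eq {d d' : Division k} (hd : d ∈ divisions k) (hd' : d' ∈ divisions k) :
    ∃ π : Equiv.Perm (Fin (2 * k + 1)), π • d = d' := by
  let π : Equiv.Perm (Fin (2 * k + 1)) := Equiv.ofFiberEquiv fun c =>
    Fintype.equivOfCardEq ((card_groupOf_fiber hd c).trans (card_groupOf_fiber hd' c).symm)
  have groupOf_π (i) : groupOf d' (π i) = groupOf d i := Equiv.ofFiberEquiv_map _ i
  have groupOf_symm (i) : groupOf d (π.symm i) = groupOf d' i := by simp [← groupOf_π]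
  refine ⟨π, Prod.ext ?_ (Prod.ext ?_ ?_)⟩
  · ext i
    simp [← Finset.inv_smul_mem_iff, ← groupOf_eq_zero_iff, groupOf_symm]
  · ext i
    simp [← Finset.inv_smul_mem_iff, ← groupOf_eq_one_iff hd, ← groupOf_eq_one_iff hd',
      groupOf_symm]
  · simp [← groupOf_eq_two_iff hd', groupOf_π, groupOf_eq_two_iff hd]

theorem coe_divisions_eq_orbit {d : Division k} (hd : d ∈ divisions k) :
    (divisions k : Set (Division k)) = MulAction.orbit (Equiv.Perm (Fin (2 * k + 1))) d := by
  ext d'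
  refine ⟨exists_perm_smul_eq hd, ?_⟩
  rintro ⟨π, rfl⟩
  exact smul_mem_divisions π hd

/-- The `k` blocks that follow `p` in the cyclic order. -/
def blocksAfter (p : Fin (2 * k + 1)) : Finset (Fin (2 * k + 1)) :=
  {i | i - p ∈ Finset.Ioc 0 ⟨k, by lia⟩}

/-- The `k` blocks that precede `p` in the cyclic order. -/
def blocksBefore (p : Fin (2 * k + 1)) : Finset (Fin (2 * k + 1)) := {i | p ∈ blocksAfter i}

theorem mem_blocksBefore {p i : Fin (2 * k + 1)} : i ∈ blocksBefore p ↔ p ∈ blocksAfter i := by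
  simp [blocksBefore]

theorem self_notMem_blocksAfter (p : Fin (2 * k + 1)) : p ∉ blocksAfter p := by
  simp [blocksAfter]

theorem mem_blocksAfter_comm_iff {p q : Fin (2 * k + 1)} (h : p ≠ q) :
    p ∈ blocksAfter q ↔ q ∉ blocksAfter p := by
  have hsum : (q - p).val + (p - q).val = 2 * k + 1 := by
    rw [← neg_sub q p, Fin.val_neg, if_neg (sub_ne_zero.2 h.symm)]
    have := (q - p).isLt
    lia
  simp only [blocksAfter, Finset.mem_filter, Finset.mem_univ, true_and, Finset.mem_Ioc,
    Fin.lt_def, Fin.le_def, Fin.val_zero]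
  have := Fin.val_ne_of_ne (sub_ne_zero.2 h)
  have := Fin.val_ne_of_ne (sub_ne_zero.2 h.symm)
  grind

theorem card_blocksAfter (p : Fin (2 * k + 1)) : (blocksAfter p).card = k := by
  have h : blocksAfter p = (Finset.Ioc 0 ⟨k, by lia⟩).map (Equiv.addRight p).toEmbedding := by
    ext i; simp [blocksAfter, sub_eq_add_neg]
  simp [h]

theorem blocksBefore_eq_compl (p : Fin (2 * k + 1)) :
    blocksBefore p = (insert p (blocksAfter p))ᶜ := by
  ext i
  rcases eq_or_ne p i with rfl | hi
  · simp [mem_blocksBefore, self_notMem_blocksAfter]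
  · simp [mem_blocksBefore, mem_blocksAfter_comm_iff hi, hi.symm]

/-- The division of the cyclically ordered blocks into the `k` blocks after `p`, the `k` blocks
before `p`, and `p` itself. -/
def cyclicDivision (p : Fin (2 * k + 1)) : Division k := (blocksAfter p, blocksBefore p, p)

theorem cyclicDivision_mem_divisions (p : Fin (2 * k + 1)) : cyclicDivision p ∈ divisions k := by
  rw [mem_divisions]
  refine ⟨card_blocksAfter p, ?_, ?_, self_notMem_blocksAfter p, ?_⟩ <;>
    simp only [cyclicDivision, blocksBefore_eq_compl]
  · rw [Finset.card_compl, Finset.card_insert_of_notMem (self_notMem_blocksAfter p),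
      card_blocksAfter, Fintype.card_fin]
    lia
  · exact disjoint_compl_right.mono_left (Finset.subset_insert _ _)
  · simp

theorem card_divisions_pos (k : ℕ) : 0 < (divisions k).card :=
  Finset.card_pos.2 ⟨_, cyclicDivision_mem_divisions 0⟩

theorem card_divisions_third_eq (i : Fin (2 * k + 1)) :
    (2 * k + 1) * {d ∈ divisions k | d.2.2 = i}.card = (divisions k).card := by
  have card_fiber_eq (j : Fin (2 * k + 1)) :
      {d ∈ divisions k | d.2.2 = j}.card = {d ∈ divisions k | d.2.2 = i}.card := by
    refine Finset.card_equiv (MulAction.toPerm (Equiv.swap i j)) fun d => ?_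
    have hmem : Equiv.swap i j • d ∈ divisions k ↔ d ∈ divisions k :=
      ⟨fun h => by simpa using smul_mem_divisions (Equiv.swap i j)⁻¹ h, smul_mem_divisions _⟩
    simp [hmem, ← Equiv.eq_symm_apply]
  rw [Finset.card_eq_sum_card_fiberwise (s := divisions k) (f := fun d => d.2.2)
    (t := Finset.univ) (by simp)]
  simp [card_fiber_eq]

/-- `d` respects `P` and `Q` if its first group lies in `P` and its second group in `Q`; this is
when the test passes if `P` and `Q` hold of the blocks that pass the two kinds of measurement. -/
def Respects (P Q : Fin (2 * k + 1) → Prop) (d : Division k) : Prop :=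
  (∀ i ∈ d.1, P i) ∧ ∀ i ∈ d.2.1, Q i

theorem respects_smul_iff {P Q : Fin (2 * k + 1) → Prop} {π : Equiv.Perm (Fin (2 * k + 1))}
    {d : Division k} : Respects P Q (π • d) ↔ Respects (P ∘ π) (Q ∘ π) d := by
  simp [Respects, ← Finset.image_smul]

/-- The division with its first and second groups exchanged. -/
def swapGroups (d : Division k) : Division k := (d.2.1, d.1, d.2.2)

theorem swapGroups_mem_divisions {d : Division k} (hd : d ∈ divisions k) :
    swapGroups d ∈ divisions k := by
  rw [mem_divisions] at hd ⊢
  exact ⟨hd.2.1, hd.1, hd.2.2.1.symm, hd.2.2.2.2, hd.2.2.2.1⟩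

theorem cyclicDivision_respects_subsingleton (P Q : Fin (2 * k + 1) → Prop) :
    {p | (Respects P Q (cyclicDivision p) ∧ ¬P p) ∨
      (Respects P Q (swapGroups (cyclicDivision p)) ∧ P p ∧ ¬Q p)}.Subsingleton := by
  intro p hp q hq
  by_contra hne
  wlog h : q ∈ blocksAfter p generalizing p q
  · exact this hq hp (Ne.symm hne) ((mem_blocksAfter_comm_iff hne).2 h)
  have h' : p ∈ blocksBefore q := mem_blocksBefore.2 h
  simp only [Set.mem_ofPred_eq, Respects, swapGroups, cyclicDivision] at hp hq
  grind

open Classical in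
theorem card_divisions_respects_le (P Q : Fin (2 * k + 1) → Prop) :
    (2 * k + 1) * {d ∈ divisions k | Respects P Q d ∧ ¬(P d.2.2 ∧ Q d.2.2)}.card ≤
      (divisions k).card := by
  let normalize (d : Division k) : Division k := if P d.2.2 then swapGroups d else d
  have card_eq : {d ∈ divisions k | Respects P Q d ∧ ¬(P d.2.2 ∧ Q d.2.2)}.card =
      {d ∈ divisions k | (Respects P Q d ∧ ¬P d.2.2) ∨
        (Respects P Q (swapGroups d) ∧ P d.2.2 ∧ ¬Q d.2.2)}.card := by
    refine Finset.card_nbij' normalize normalize ?_ ?_ ?_ ?_ <;> intro d hd <;>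
      have hswap := swapGroups_mem_divisions (d := d) <;>
      rw [Finset.mem_coe, Finset.mem_filter] at * <;>
      by_cases hP : P d.2.2 <;> simp_all [normalize, swapGroups]
  rw [card_eq]
  simpa using card_mul_card_filter_le_of_orbit
    (fun p => coe_divisions_eq_orbit (cyclicDivision_mem_divisions p)) _ fun π => by
      have hsub := cyclicDivision_respects_subsingleton (P ∘ π) (Q ∘ π)
      simp only [← respects_smul_iff] at hsub
      exact hsub

end Divisions

section PureState

variable {κ : Type*}

theorem pureState_apply (ψ : κ → ℂ) (a b : κ) : pureState ψ a b = ψ a * star (ψ b) := rfl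

theorem pureState_smul {c : ℂ} (hc : c * star c = 1) (ψ : κ → ℂ) :
    pureState (c • ψ) = pureState ψ := by
  ext a b
  simp only [pureState_apply, Pi.smul_apply, smul_eq_mul, star_mul']
  rw [mul_mul_mul_comm, hc, one_mul]

theorem sum_pureState_mul_apply {σ : Type*} (s : Finset σ) (K : σ → κ → ℂ) (θ : κ → ℂ)
    (a b : κ) :
    (∑ i ∈ s, pureState (θ * K i)) a b = θ a * star (θ b) * (∑ i ∈ s, pureState (K i)) a b := by
  simp only [Matrix.sum_apply, pureState_apply, Pi.mul_apply, star_mul', Finset.mul_sum,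
    mul_mul_mul_comm]

variable [Fintype κ] [DecidableEq κ]

theorem star_dotProduct_of_sum_pureState_eq_one {K : κ → κ → ℂ}
    (hK : ∑ s, pureState (K s) = 1) (s t : κ) :
    star (K s) ⬝ᵥ K t = if s = t then 1 else 0 := by
  let U : Matrix κ κ ℂ := Matrix.of fun a s => K s a
  have mul_conjTranspose : U * Uᴴ = 1 := by
    rw [← hK]
    ext a b
    simp [U, Matrix.mul_apply, Matrix.sum_apply, pureState_apply]
  have conjTranspose_mul : Uᴴ * U = 1 := mul_eq_one_comm.1 mul_conjTranspose
  simpa [U, Matrix.mul_apply, Matrix.one_apply, dotProduct] using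
    congrFun (congrFun conjTranspose_mul s) t

theorem sum_star_dotProduct_mulVec_of_sum_pureState_eq_one {K : κ → κ → ℂ}
    (hK : ∑ s, pureState (K s) = 1) (M : Matrix κ κ ℂ) :
    ∑ s, star (K s) ⬝ᵥ (M *ᵥ K s) = M.trace := by
  conv_rhs => rw [← mul_one M, ← hK, Finset.mul_sum, Matrix.trace_sum]
  refine Finset.sum_congr rfl fun s _ => ?_
  rw [pureState, Matrix.mul_vecMulVec, Matrix.trace_vecMulVec, dotProduct_comm]

theorem sum_pureState_mul_eq_one {K : κ → κ → ℂ} (hK : ∑ s, pureState (K s) = 1)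
    {θ : κ → ℂ} (hθ : ∀ a, θ a * star (θ a) = 1) : ∑ s, pureState (θ * K s) = 1 := by
  ext a b
  rw [sum_pureState_mul_apply, hK, Matrix.one_apply]
  split_ifs with h
  · rw [h, hθ, one_mul]
  · rw [mul_zero]

end PureState

section ProdKet

variable {ι κ : Type*} [Fintype ι]

/-- The tensor product `⨂ i, ψ i` of the vectors `ψ i`. -/
def prodKet (ψ : ι → κ → ℂ) : (ι → κ) → ℂ := fun w => ∏ i, ψ i (w i)

variable [DecidableEq ι]

theorem sum_pureState_prodKet_apply {σ : Type*} (K : ι → σ → κ → ℂ) (C : ι → Finset σ)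
    (w w' : ι → κ) :
    (∑ o ∈ Fintype.piFinset C, pureState (prodKet fun i => K i (o i))) w w' =
      ∏ i, (∑ c ∈ C i, pureState (K i c)) (w i) (w' i) := by
  simp [Matrix.sum_apply, Finset.prod_univ_sum, pureState_apply, prodKet, Finset.prod_mul_distrib]

theorem sum_pureState_prodKet_congr {σ σ' : Type*} {K : ι → σ → κ → ℂ} {C : ι → Finset σ}
    {K' : ι → σ' → κ → ℂ} {C' : ι → Finset σ'}
    (h : ∀ i, ∑ c ∈ C i, pureState (K i c) = ∑ c ∈ C' i, pureState (K' i c)) :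
    ∑ o ∈ Fintype.piFinset C, pureState (prodKet fun i => K i (o i)) =
      ∑ o ∈ Fintype.piFinset C', pureState (prodKet fun i => K' i (o i)) := by
  ext w w'
  simp only [sum_pureState_prodKet_apply, h]

theorem sum_pureState_prodKet_eq_one [Fintype κ] [DecidableEq κ] {K : ι → κ → κ → ℂ}
    (hK : ∀ i, ∑ c, pureState (K i c) = 1) :
    ∑ o : ι → κ, pureState (prodKet fun i => K i (o i)) = 1 := by
  ext w w'
  rw [← Fintype.piFinset_univ, sum_pureState_prodKet_apply]
  simp [hK, Matrix.one_apply, funext_iff, Fintype.prod_boole]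

end ProdKet

section Contraction

variable {ι κ : Type*} [DecidableEq κ] {t : ι}

/-- The operator `(⨂_{i ≠ t} ⟨·|) ⊗ 1_t` that contracts every factor but `t` with `φ`. -/
def contractAt (t : ι) (φ : ({i // i ≠ t} → κ) → ℂ) : Matrix κ (ι → κ) ℂ :=
  Matrix.of fun a w => if w t = a then star (φ fun i => w i) else 0

variable [Fintype κ]

theorem conjTranspose_contractAt_mulVec_prodKet [Fintype ι] [DecidableEq ι] (ψ : ι → κ → ℂ) :
    (contractAt t (prodKet fun i : {i // i ≠ t} => ψ i))ᴴ *ᵥ ψ t = prodKet ψ := by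
  ext w
  simp [Matrix.mulVec, dotProduct, contractAt, prodKet, apply_ite,
    Fintype.prod_eq_mul_prod_subtype_ne _ t, mul_comm]

variable [Fintype ι] [DecidableEq ι]

theorem contractAt_mul_mul_conjTranspose_apply (φ : ({i // i ≠ t} → κ) → ℂ)
    (ρ : Matrix (ι → κ) (ι → κ) ℂ) (a b : κ) :
    (contractAt t φ * ρ * (contractAt t φ)ᴴ) a b =
      ∑ w' with w' t = b, ∑ w with w t = a,
        ρ w w' * pureState φ (fun i => w' i) (fun i => w i) := by
  simp only [Matrix.mul_apply, contractAt, Matrix.conjTranspose_apply, Matrix.of_apply, ite_mul,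
    zero_mul, apply_ite star, star_star, star_zero, mul_ite, mul_zero, ← Finset.sum_filter,
    pureState_apply, Finset.sum_mul]
  refine Finset.sum_congr rfl fun w' _ => Finset.sum_congr rfl fun w _ => ?_
  ring

theorem sum_contractAt_apply {σ : Type*} (s : Finset σ) (φ : σ → ({i // i ≠ t} → κ) → ℂ)
    (ρ : Matrix (ι → κ) (ι → κ) ℂ) (a b : κ) :
    (∑ o ∈ s, contractAt t (φ o) * ρ * (contractAt t (φ o))ᴴ) a b =
      ∑ w' with w' t = b, ∑ w with w t = a,
        ρ w w' * (∑ o ∈ s, pureState (φ o)) (fun i => w' i) (fun i => w i) := by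
  simp only [Matrix.sum_apply, contractAt_mul_mul_conjTranspose_apply, Finset.mul_sum]
  rw [Finset.sum_comm]
  exact Finset.sum_congr rfl fun _ _ => Finset.sum_comm

theorem sum_contractAt_congr {σ σ' : Type*} {s : Finset σ} {s' : Finset σ'}
    {φ : σ → ({i // i ≠ t} → κ) → ℂ} {φ' : σ' → ({i // i ≠ t} → κ) → ℂ}
    (h : ∑ o ∈ s, pureState (φ o) = ∑ o ∈ s', pureState (φ' o))
    (ρ : Matrix (ι → κ) (ι → κ) ℂ) :
    ∑ o ∈ s, contractAt t (φ o) * ρ * (contractAt t (φ o))ᴴ =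
      ∑ o ∈ s', contractAt t (φ' o) * ρ * (contractAt t (φ' o))ᴴ := by
  ext a b
  rw [sum_contractAt_apply, sum_contractAt_apply, h]

end Contraction

section Qubit

/-- The sign `(-1)^a`. -/
def sgn : AddChar (ZMod 2) ℂ := AddChar.zmodChar 2 (ζ := -1) (by norm_num)

theorem eq_zero_or_eq_one (a : ZMod 2) : a = 0 ∨ a = 1 := by
  decide +revert

theorem sgn_apply (a : ZMod 2) : sgn a = if a = 1 then -1 else 1 := by
  rcases eq_zero_or_eq_one a with rfl | rfl <;>
    simp [sgn, AddChar.zmodChar_apply, ZMod.val_one]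

theorem sgn_sum {ι : Type*} (s : Finset ι) (f : ι → ZMod 2) :
    sgn (∑ i ∈ s, f i) = ∏ i ∈ s, sgn (f i) :=
  map_prod sgn.toMonoidHom (fun i => Multiplicative.ofAdd (f i)) s

theorem xKet_eq_sgn_mul (b a : ZMod 2) : xKet b a = sgn (a * b) * xKet 0 a := by
  rcases eq_zero_or_eq_one a with rfl | rfl <;> rcases eq_zero_or_eq_one b with rfl | rfl <;>
    simp [xKet, sgn_apply, neg_div]

theorem sum_pureState_zKet : ∑ b, pureState (zKet b) = 1 := by
  ext a a'
  simp [Matrix.sum_apply, pureState_apply, zKet, Matrix.one_apply, apply_ite, eq_comm]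

theorem sum_pureState_xKet : ∑ b, pureState (xKet b) = 1 := by
  have inv_sqrt_mul_self : (√2 : ℂ)⁻¹ * (√2 : ℂ)⁻¹ = 2⁻¹ := by
    rw [← mul_inv, ← Complex.ofReal_mul, Real.mul_self_sqrt zero_le_two, Complex.ofReal_ofNat]
  have sum_zmod (f : ZMod 2 → ℂ) : ∑ b, f b = f 0 + f 1 := Fin.sum_univ_two f
  ext a a'
  rcases eq_zero_or_eq_one a with rfl | rfl <;> rcases eq_zero_or_eq_one a' with rfl | rfl <;>
    norm_num [Matrix.sum_apply, pureState_apply, xKet, Matrix.one_apply, sum_zmod,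
      div_eq_mul_inv, inv_sqrt_mul_self]

end Qubit

section EdgeSign

variable {V : Type*} [Fintype V] [DecidableEq V]

/-- The sign `(-1)^m`, where `m` is the number of edges in `E` both of whose ends have label `1`;
it is the diagonal entry at `z` of the product of the gates `cz e`, `e ∈ E`. -/
def edgeSign (E : Finset (Sym2 V)) (z : Bits V) : ℂ :=
  ∏ e ∈ E, if ∀ v ∈ e, z v = 1 then -1 else 1

theorem edgeSign_mul_star_self (E : Finset (Sym2 V)) (z : Bits V) :
    edgeSign E z * star (edgeSign E z) = 1 := by
  simp only [edgeSign, star_prod, ← Finset.prod_mul_distrib]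
  exact Finset.prod_eq_one fun e _ => by split_ifs <;> simp

theorem edgeSign_congr {E : Finset (Sym2 V)} {z z' : Bits V} (h : ∀ e ∈ E, ∀ v ∈ e, z v = z' v) :
    edgeSign E z = edgeSign E z' :=
  Finset.prod_congr rfl fun e he => by
    have forall_iff : (∀ v ∈ e, z v = 1) ↔ ∀ v ∈ e, z' v = 1 :=
      forall₂_congr fun v hv => by rw [h e he v hv]
    simp only [forall_iff]

theorem noncommProd_cz (E : Finset (Sym2 V))
    (comm : (E : Set (Sym2 V)).Pairwise (Function.onFun Commute cz)) :
    E.noncommProd cz comm = Matrix.diagonal (edgeSign E) := by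
  induction E using Finset.induction_on with
  | empty => rw [Finset.noncommProd_empty]; rfl
  | insert e E he ih =>
    rw [Finset.noncommProd_insert_of_notMem _ _ _ _ he, ih, cz, Matrix.diagonal_mul_diagonal]
    congr 1
    ext z
    rw [edgeSign, edgeSign, Finset.prod_insert he]

variable (G : SimpleGraph V) [DecidableRel G.Adj]

theorem edgeSign_incidenceFinset (v : V) (z : Bits V) :
    edgeSign (G.incidenceFinset v) z = sgn (z v * ∑ i ∈ G.neighborFinset v, z i) := by
  have image_eq : G.incidenceFinset v = (G.neighborFinset v).image (s(v, ·)) := by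
    ext e
    induction e
    simp only [SimpleGraph.mem_incidenceFinset, SimpleGraph.mk'_mem_incidenceSet_iff,
      Finset.mem_image, SimpleGraph.mem_neighborFinset, Sym2.eq_iff]
    grind [SimpleGraph.adj_comm]
  have mul_eq_one_iff : ∀ a b : ZMod 2, a * b = 1 ↔ a = 1 ∧ b = 1 := by decide
  rw [Finset.mul_sum, sgn_sum, edgeSign, image_eq,
    Finset.prod_image fun _ _ _ _ h => Sym2.congr_right.1 h]
  refine Finset.prod_congr rfl fun i _ => ?_
  simp [sgn_apply, mul_eq_one_iff]

variable {G}

theorem edgeSign_eq_prod_sgn_mul {S : Finset V} (hS : G.IsIndepSet S) (z : Bits V) :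
    edgeSign G.edgeFinset z =
      (∏ v ∈ S, sgn (z v * ∑ i ∈ G.neighborFinset v, z i)) *
        edgeSign {e ∈ G.edgeFinset | ∀ v ∈ e, v ∉ S} z := by
  have disj : (S : Set V).PairwiseDisjoint (G.incidenceFinset ·) := by
    intro v hv w hw hvw
    simp only [Function.onFun, ← Finset.disjoint_coe, SimpleGraph.coe_incidenceFinset,
      Set.disjoint_iff_inter_eq_empty]
    exact G.incidenceSet_inter_incidenceSet_of_not_adj (hS hv hw hvw) hvw
  have touching_eq : {e ∈ G.edgeFinset | ¬∀ v ∈ e, v ∉ S} = S.biUnion (G.incidenceFinset ·) := by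
    ext e
    simp only [Finset.mem_filter, SimpleGraph.mem_edgeFinset, Finset.mem_biUnion,
      SimpleGraph.mem_incidenceFinset, SimpleGraph.incidenceSet, Set.mem_ofPred_eq]
    grind
  simp only [← edgeSign_incidenceFinset]
  rw [edgeSign, ← Finset.prod_filter_not_mul_prod_filter _ (fun e => ∀ v ∈ e, v ∉ S),
    touching_eq, Finset.prod_biUnion disj]
  rfl

end EdgeSign

section GraphKet

variable {V : Type*} [Fintype V] [DecidableEq V] (G : SimpleGraph V) [DecidableRel G.Adj]

/-- The vector `(∏_j Z_j^{s j}) |G⟩` of the graph basis, the joint eigenvector of the stabilizers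
of the graph state with eigenvalues `(-1)^{s j}`. -/
def graphKet (s : Bits V) : Bits V → ℂ := edgeSign G.edgeFinset * prodKet fun v => xKet (s v)

theorem graphKet_zero : graphKet G 0 = graphState G := by
  have hcz := noncommProd_cz G.edgeFinset fun _ _ _ _ _ => Matrix.commute_diagonal _ _
  ext z
  rw [graphState, hcz, Matrix.mulVec_diagonal]
  rfl

theorem sum_pureState_graphKet : ∑ s, pureState (graphKet G s) = 1 :=
  sum_pureState_mul_eq_one (sum_pureState_prodKet_eq_one fun _ => sum_pureState_xKet)
    (edgeSign_mul_star_self _)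

end GraphKet

section Block

variable {V : Type*} [Fintype V] [DecidableEq V] {G : SimpleGraph V} [DecidableRel G.Adj]
  {S : Finset V}

theorem outcomeKet_eq_prodKet (S : Finset V) (o : Bits V) :
    outcomeKet S o = prodKet fun v => if v ∈ S then xKet (o v) else zKet (o v) := by
  ext z
  simp only [outcomeKet, prodKet, ite_apply]

theorem outcomeKet_eq_zero {o z : Bits V} {v : V} (hv : v ∉ S) (hz : z v ≠ o v) :
    outcomeKet S o z = 0 :=
  Finset.prod_eq_zero (Finset.mem_univ v) (by simp [hv, hz, zKet])

theorem outcomeKet_eq_prod_sgn_mul (S : Finset V) (o z : Bits V) :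
    outcomeKet S o z = (∏ v ∈ S, sgn (z v * o v)) * outcomeKet S (S.piecewise 0 o) z := by
  rw [outcomeKet, outcomeKet, ← Finset.prod_ite_mem_eq S, ← Finset.prod_mul_distrib]
  refine Finset.prod_congr rfl fun v _ => ?_
  by_cases hv : v ∈ S
  · simp [hv, ← xKet_eq_sgn_mul]
  · simp [hv]

omit [DecidableEq V] in
theorem sum_neighborFinset_congr (hS : G.IsIndepSet S) {z z' : Bits V}
    (h : ∀ v ∉ S, z v = z' v) {v : V} (hv : v ∈ S) :
    ∑ i ∈ G.neighborFinset v, z i = ∑ i ∈ G.neighborFinset v, z' i :=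
  Finset.sum_congr rfl fun i hi => h i fun hiS =>
    have hadj : G.Adj v i := (G.mem_neighborFinset v i).1 hi
    hS hv hiS hadj.ne hadj

theorem edgeSign_mul_outcomeKet_of_consistent (hS : G.IsIndepSet S) {o : Bits V}
    (ho : Consistent G S o) :
    edgeSign G.edgeFinset * outcomeKet S (S.piecewise 0 o) =
      edgeSign {e ∈ G.edgeFinset | ∀ v ∈ e, v ∉ S} o • outcomeKet S o := by
  ext z
  rw [Pi.smul_apply, Pi.mul_apply, smul_eq_mul]
  by_cases hz : ∀ v ∉ S, z v = o v
  · have sgn_eq : ∏ v ∈ S, sgn (z v * o v) =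
        ∏ v ∈ S, sgn (z v * ∑ i ∈ G.neighborFinset v, z i) :=
      Finset.prod_congr rfl fun v hv => by rw [ho v hv, sum_neighborFinset_congr hS hz hv]
    have avoiding_eq : edgeSign {e ∈ G.edgeFinset | ∀ v ∈ e, v ∉ S} z =
        edgeSign {e ∈ G.edgeFinset | ∀ v ∈ e, v ∉ S} o :=
      edgeSign_congr fun e he v hv => hz v ((Finset.mem_filter.1 he).2 v hv)
    rw [outcomeKet_eq_prod_sgn_mul S o, edgeSign_eq_prod_sgn_mul hS z, sgn_eq, avoiding_eq]
    ring
  · push Not at hz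
    obtain ⟨v, hv, hzv⟩ := hz
    rw [outcomeKet_eq_zero hv hzv, outcomeKet_eq_zero hv (by simpa [hv] using hzv), mul_zero,
      mul_zero]

theorem sum_consistent_eq_sum_vanishing {M : Type*} [AddCommMonoid M]
    [DecidablePred (Consistent G S)] (hS : G.IsIndepSet S) (f : Bits V → M) :
    ∑ o with Consistent G S o, f (S.piecewise 0 o) = ∑ o with ∀ v ∈ S, o v = 0, f o := by
  let predict (s : Bits V) : Bits V := S.piecewise (fun v => ∑ i ∈ G.neighborFinset v, s i) s
  have predict_congr {z z' : Bits V} (h : ∀ v ∉ S, z v = z' v) : predict z = predict z' := by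
    ext v
    by_cases hv : v ∈ S
    · simpa [predict, hv] using sum_neighborFinset_congr hS h hv
    · simpa [predict, hv] using h v hv
  have consistent_iff (o : Bits V) : Consistent G S o ↔ predict o = o := by
    simp [Consistent, predict, Finset.piecewise, funext_iff, eq_comm]
  refine Finset.sum_nbij' (S.piecewise 0 ·) predict ?_ ?_ ?_ ?_ fun _ _ => rfl
  · simp +contextual
  · intro s _
    simpa [consistent_iff] using predict_congr (z := predict s) (by simp +contextual [predict])
  · intro o ho
    rw [← (consistent_iff o).1 (Finset.mem_filter.1 ho).2]
    exact predict_congr (by simp +contextual [predict])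
  · intro s hs
    ext v
    by_cases hv : v ∈ S
    · simp [hv, (Finset.mem_filter.1 hs).2 v hv]
    · simp [predict, hv]

theorem sum_pureState_outcomeKet_of_consistent [DecidablePred (Consistent G S)]
    (hS : G.IsIndepSet S) :
    ∑ o with Consistent G S o, pureState (outcomeKet S o) =
      ∑ s with ∀ v ∈ S, s v = 0, pureState (graphKet G s) := by
  let C (v : V) : Finset (ZMod 2) := if v ∈ S then {0} else Finset.univ
  have filter_eq : ({s | ∀ v ∈ S, s v = 0} : Finset (Bits V)) = Fintype.piFinset C := by
    ext s
    simp only [Finset.mem_filter, Finset.mem_univ, true_and, C, Fintype.mem_piFinset]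
    refine forall_congr' fun v => ?_
    split_ifs with hv <;> simp [hv]
  have sum_prodKet_eq : ∑ s ∈ Fintype.piFinset C, pureState (outcomeKet S s) =
      ∑ s ∈ Fintype.piFinset C, pureState (prodKet fun v => xKet (s v)) := by
    simp only [outcomeKet_eq_prodKet]
    refine sum_pureState_prodKet_congr (K := fun v b => if v ∈ S then xKet b else zKet b)
      fun v => ?_
    by_cases hv : v ∈ S
    · simp [C, hv]
    · simp [C, hv, sum_pureState_zKet, sum_pureState_xKet]
  calc ∑ o with Consistent G S o, pureState (outcomeKet S o)
      = ∑ o with Consistent G S o,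
          pureState (edgeSign G.edgeFinset * outcomeKet S (S.piecewise 0 o)) :=
        Finset.sum_congr rfl fun o ho => by
          rw [edgeSign_mul_outcomeKet_of_consistent hS (Finset.mem_filter.1 ho).2,
            pureState_smul (edgeSign_mul_star_self _ _)]
    _ = ∑ s with ∀ v ∈ S, s v = 0, pureState (edgeSign G.edgeFinset * outcomeKet S s) :=
        sum_consistent_eq_sum_vanishing hS fun s =>
          pureState (edgeSign G.edgeFinset * outcomeKet S s)
    _ = ∑ s with ∀ v ∈ S, s v = 0, pureState (graphKet G s) := by
        ext z z'
        simp only [graphKet]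
        rw [sum_pureState_mul_apply, sum_pureState_mul_apply, filter_eq, sum_prodKet_eq]

end Block

section Expectation

variable {κ : Type*} [Fintype κ]

/-- The expectation value `⟨ψ|M|ψ⟩`, which for a state `M` and a vector `ψ` of an orthonormal basis
is the probability of the outcome `ψ` when `M` is measured in that basis. -/
def expectation (M : Matrix κ κ ℂ) (ψ : κ → ℂ) : ℝ := (star ψ ⬝ᵥ (M *ᵥ ψ)).re

theorem expectation_sum {σ : Type*} (s : Finset σ) (M : σ → Matrix κ κ ℂ) (ψ : κ → ℂ) :
    expectation (∑ i ∈ s, M i) ψ = ∑ i ∈ s, expectation (M i) ψ := by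
  simp only [expectation, Matrix.sum_mulVec, dotProduct_sum, Complex.re_sum]

theorem expectation_ofReal_smul (c : ℝ) (M : Matrix κ κ ℂ) (ψ : κ → ℂ) :
    expectation ((c : ℂ) • M) ψ = c * expectation M ψ := by
  rw [expectation, Matrix.smul_mulVec, dotProduct_smul, smul_eq_mul, Complex.re_ofReal_mul,
    expectation]

theorem expectation_mul_mul_conjTranspose {κ' : Type*} [Fintype κ'] (A : Matrix κ κ' ℂ)
    (M : Matrix κ' κ' ℂ) (ψ : κ → ℂ) :
    expectation (A * M * Aᴴ) ψ = expectation M (Aᴴ *ᵥ ψ) := by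
  rw [expectation, expectation, ← Matrix.mulVec_mulVec, ← Matrix.mulVec_mulVec,
    Matrix.dotProduct_mulVec, Matrix.star_mulVec, Matrix.conjTranspose_conjTranspose]

theorem expectation_nonneg {M : Matrix κ κ ℂ} (hM : M.PosSemidef) (ψ : κ → ℂ) :
    0 ≤ expectation M ψ :=
  (Complex.nonneg_iff.1 (hM.dotProduct_mulVec_nonneg ψ)).1

theorem isDensity_pureState {ψ : κ → ℂ} (hψ : star ψ ⬝ᵥ ψ = 1) : IsDensity (pureState ψ) :=
  ⟨Matrix.posSemidef_vecMulVec_self_star ψ, by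
    rw [pureState, Matrix.trace_vecMulVec, dotProduct_comm, hψ]⟩

variable [DecidableEq κ] {K : κ → κ → ℂ}

theorem sum_expectation_of_sum_pureState_eq_one (hK : ∑ s, pureState (K s) = 1)
    (M : Matrix κ κ ℂ) : ∑ s, expectation M (K s) = M.trace.re := by
  simp only [expectation]
  rw [← Complex.re_sum, sum_star_dotProduct_mulVec_of_sum_pureState_eq_one hK]

theorem expectation_pureState_of_sum_pureState_eq_one (hK : ∑ s, pureState (K s) = 1) (s t : κ) :
    expectation (pureState (K t)) (K s) = if s = t then 1 else 0 := by
  rw [expectation, pureState, Matrix.vecMulVec_mulVec]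
  by_cases h : s = t <;> simp [star_dotProduct_of_sum_pureState_eq_one hK, h, eq_comm]

end Expectation

section Slice

variable {ι κ σ : Type*} [Fintype ι] [DecidableEq ι] [Fintype κ] [DecidableEq κ]

theorem expectation_sum_contractAt [Fintype σ] [DecidableEq σ] (K : σ → κ → ℂ) (t : ι) (τ : σ)
    (p : ({i // i ≠ t} → σ) → Prop) [DecidablePred p] (ρ : Matrix (ι → κ) (ι → κ) ℂ) :
    expectation (∑ s with p s, contractAt t (prodKet fun i => K (s i)) * ρ *
        (contractAt t (prodKet fun i => K (s i)))ᴴ) (K τ) =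
      ∑ s : ι → σ with s t = τ ∧ p fun i => s i, expectation ρ (prodKet fun i => K (s i)) := by
  have split_extend (s : {i // i ≠ t} → σ) :=
    (Equiv.funSplitAt t σ).apply_symm_apply (τ, s)
  have extend_apply_self (s) : (Equiv.funSplitAt t σ).symm (τ, s) t = τ :=
    congrArg Prod.fst (split_extend s)
  have restrict_extend (s) :
      (fun i : {i // i ≠ t} => (Equiv.funSplitAt t σ).symm (τ, s) i) = s :=
    congrArg Prod.snd (split_extend s)
  rw [expectation_sum]
  symm
  refine Finset.sum_nbij' (fun s i => s i) (fun s => (Equiv.funSplitAt t σ).symm (τ, s))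
    ?_ ?_ ?_ (fun s _ => restrict_extend s) ?_
  · simp +contextual
  · intro s hs
    rw [Finset.mem_filter, restrict_extend]
    exact ⟨Finset.mem_univ _, extend_apply_self s, (Finset.mem_filter.1 hs).2⟩
  · intro s hs
    rw [← (Finset.mem_filter.1 hs).2.1]
    exact (Equiv.funSplitAt t σ).symm_apply_apply s
  · intro s hs
    rw [expectation_mul_mul_conjTranspose, ← (Finset.mem_filter.1 hs).2.1,
      conjTranspose_contractAt_mulVec_prodKet fun i => K (s i)]

end Slice

section Acceptance

variable {V : Type*} {k : ℕ} {W B : Finset V}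

/-- A state with graph basis labels `s` passes the test with division `d`. -/
def Accepts (W B : Finset V) (s : Blocks V k) (d : Division k) : Prop :=
  ∀ i : {i // i ≠ d.2.2}, ∀ v ∈ xSites W B d.1 i, s i v = 0

theorem accepts_iff_respects {d : Division k} (hd : d ∈ divisions k) {s : Blocks V k} :
    Accepts W B s d ↔ Respects (fun i => ∀ v ∈ B, s i v = 0) (fun i => ∀ v ∈ W, s i v = 0) d := by
  have third (i) := notMem_groups_iff_eq_third hd (i := i)
  have disj := Finset.disjoint_left.1 (mem_divisions.1 hd).2.2.1
  simp only [Accepts, Respects, xSites, Subtype.forall]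
  grind

theorem accepts_single_iff (hW : W.Nonempty) (hB : B.Nonempty)
    (i : Fin (2 * k + 1)) (d : Division k) :
    Accepts W B (Pi.single i 1) d ↔ d.2.2 = i := by
  have nonempty_xSites : (xSites W B d.1 i).Nonempty := by
    unfold xSites
    split_ifs <;> assumption
  obtain ⟨v, hv⟩ := nonempty_xSites
  constructor
  · intro h
    by_contra hi
    simpa using h ⟨i, Ne.symm hi⟩ v hv
  · rintro rfl j v _
    simp [j.2]

open Classical in
theorem card_divisions_accepts_le [Fintype V] [DecidableEq V] (hWB : W ∪ B = Finset.univ)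
    (s : Blocks V k) :
    (2 * k + 1) * {d ∈ divisions k | Accepts W B s d ∧ s d.2.2 ≠ 0}.card ≤
      (divisions k).card := by
  have eq_zero_iff (i) : (∀ v ∈ B, s i v = 0) ∧ (∀ v ∈ W, s i v = 0) ↔ s i = 0 := by
    rw [and_comm, ← Finset.forall_mem_union, hWB, funext_iff]
    simp
  convert card_divisions_respects_le (k := k) (fun i => ∀ v ∈ B, s i v = 0)
    (fun i => ∀ v ∈ W, s i v = 0) using 4 with d hd
  rw [accepts_iff_respects hd, eq_zero_iff]

end Acceptance

section BlocksKet

variable {V ι : Type*} [Fintype V] [DecidableEq V] [Fintype ι] (G : SimpleGraph V)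
  [DecidableRel G.Adj]

/-- The tensor product over the blocks `i` of the graph basis vectors with labels `s i`. -/
def blocksKet (s : ι → Bits V) : (ι → Bits V) → ℂ := prodKet fun i => graphKet G (s i)

theorem sum_pureState_blocksKet [DecidableEq ι] :
    ∑ s : ι → Bits V, pureState (blocksKet G s) = 1 :=
  sum_pureState_prodKet_eq_one fun _ => sum_pureState_graphKet G

theorem oneWrong_graphKet {k : ℕ} (s : Bits V) (i : Fin (2 * k + 1)) :
    oneWrong G (graphKet G s) i = blocksKet G (Pi.single i s) := by
  ext w
  refine Finset.prod_congr rfl fun j _ => ?_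
  by_cases hj : j = i
  · subst hj; simp
  · simp [hj, graphKet_zero]

end BlocksKet

section Test

variable {V : Type*} [Fintype V] [DecidableEq V] {G : SimpleGraph V} [DecidableRel G.Adj] {k : ℕ}
  {W B : Finset V} {ρ : Matrix (Blocks V k) (Blocks V k) ℂ}

theorem fidelity_eq_expectation (σ : Matrix (Bits V) (Bits V) ℂ) :
    fidelity G σ = expectation σ (graphKet G 0) := by
  rw [graphKet_zero]; rfl

theorem outcomeOp_eq_contractAt (W B : Finset V) (first : Finset (Fin (2 * k + 1)))
    (third : Fin (2 * k + 1)) (o : {i // i ≠ third} → Bits V) :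
    outcomeOp W B first third o =
      contractAt third (prodKet fun i => outcomeKet (xSites W B first i) (o i)) := by
  ext a w
  simp [outcomeOp, contractAt, prodKet]

open Classical in
theorem sum_outcomeOp_of_consistent (hW : G.IsIndepSet W) (hB : G.IsIndepSet B) (d : Division k)
    (ρ : Matrix (Blocks V k) (Blocks V k) ℂ) :
    ∑ o : {i // i ≠ d.2.2} → Bits V with
        ∀ i : {i // i ≠ d.2.2}, Consistent G (xSites W B d.1 i) (o i),
      outcomeOp W B d.1 d.2.2 o * ρ * (outcomeOp W B d.1 d.2.2 o)ᴴ =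
    ∑ s : {i // i ≠ d.2.2} → Bits V with
        ∀ i : {i // i ≠ d.2.2}, ∀ v ∈ xSites W B d.1 i, s i v = 0,
      contractAt d.2.2 (blocksKet G s) * ρ * (contractAt d.2.2 (blocksKet G s))ᴴ := by
  have hS (i) : G.IsIndepSet (xSites W B d.1 i : Set V) := by
    unfold xSites
    split_ifs <;> assumption
  have consistent_eq : ({o | ∀ i : {i // i ≠ d.2.2}, Consistent G (xSites W B d.1 i) (o i)} :
      Finset ({i // i ≠ d.2.2} → Bits V)) =
      Fintype.piFinset fun i : {i // i ≠ d.2.2} => {o | Consistent G (xSites W B d.1 i) o} := by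
    ext; simp
  have vanishing_eq : ({s | ∀ i : {i // i ≠ d.2.2}, ∀ v ∈ xSites W B d.1 i, s i v = 0} :
      Finset ({i // i ≠ d.2.2} → Bits V)) =
      Fintype.piFinset fun i : {i // i ≠ d.2.2} => {s | ∀ v ∈ xSites W B d.1 i, s v = 0} := by
    ext; simp
  simp only [outcomeOp_eq_contractAt]
  refine sum_contractAt_congr ?_ ρ
  rw [consistent_eq, vanishing_eq]
  exact sum_pureState_prodKet_congr
    (K := fun i : {i // i ≠ d.2.2} => outcomeKet (xSites W B d.1 i))
    fun i => sum_pureState_outcomeKet_of_consistent (hS i)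

open Classical in
theorem expectation_passedState (hW : G.IsIndepSet W) (hB : G.IsIndepSet B)
    (ρ : Matrix (Blocks V k) (Blocks V k) ℂ) (τ : Bits V) :
    expectation (passedState G W B ρ) (graphKet G τ) =
      (∑ s, expectation ρ (blocksKet G s) *
        {d ∈ divisions k | Accepts W B s d ∧ s d.2.2 = τ}.card) / (divisions k).card := by
  have expectation_division (d : Division k) :
      expectation (∑ o : {i // i ≠ d.2.2} → Bits V with
          ∀ i : {i // i ≠ d.2.2}, Consistent G (xSites W B d.1 i) (o i),
        outcomeOp W B d.1 d.2.2 o * ρ * (outcomeOp W B d.1 d.2.2 o)ᴴ) (graphKet G τ) =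
      ∑ s, if Accepts W B s d ∧ s d.2.2 = τ then expectation ρ (blocksKet G s) else 0 := by
    rw [sum_outcomeOp_of_consistent hW hB, ← Finset.sum_filter]
    simp only [and_comm (b := _ = τ), blocksKet, Accepts]
    exact expectation_sum_contractAt (graphKet G) d.2.2 τ _ ρ
  rw [passedState, ← Complex.ofReal_natCast, ← Complex.ofReal_inv, expectation_ofReal_smul,
    expectation_sum, inv_mul_eq_div, Finset.sum_congr rfl fun d _ => expectation_division d,
    Finset.sum_comm]
  simp only [← Finset.sum_filter, Finset.sum_const, nsmul_eq_mul, mul_comm]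

open Classical in
theorem passProb_eq_sum (hW : G.IsIndepSet W) (hB : G.IsIndepSet B)
    (ρ : Matrix (Blocks V k) (Blocks V k) ℂ) :
    passProb G W B ρ =
      (∑ s, expectation ρ (blocksKet G s) * {d ∈ divisions k | Accepts W B s d}.card) /
        (divisions k).card := by
  have card_eq (s : Blocks V k) : {d ∈ divisions k | Accepts W B s d}.card =
      ∑ τ, {d ∈ divisions k | Accepts W B s d ∧ s d.2.2 = τ}.card := by
    simp only [← Finset.filter_filter]
    exact Finset.card_eq_sum_card_fiberwise (by simp)
  rw [passProb, ← sum_expectation_of_sum_pureState_eq_one (sum_pureState_graphKet G)]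
  simp only [expectation_passedState hW hB, ← Finset.sum_div, card_eq, Nat.cast_sum,
    Finset.mul_sum]
  rw [Finset.sum_comm]

theorem sum_expectation_blocksKet (hρ : IsDensity ρ) : ∑ s, expectation ρ (blocksKet G s) = 1 := by
  rw [sum_expectation_of_sum_pureState_eq_one (sum_pureState_blocksKet G), hρ.2, Complex.one_re]

theorem sum_expectation_blocksKet_mul_le (hρ : IsDensity ρ) {c : Blocks V k → ℝ} {b : ℝ}
    (hc : ∀ s, c s ≤ b) : ∑ s, expectation ρ (blocksKet G s) * c s ≤ b :=
  calc ∑ s, expectation ρ (blocksKet G s) * c s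
      ≤ ∑ s, expectation ρ (blocksKet G s) * b :=
        Finset.sum_le_sum fun s _ =>
          mul_le_mul_of_nonneg_left (hc s) (expectation_nonneg hρ.1 _)
    _ = b := by rw [← Finset.sum_mul, sum_expectation_blocksKet hρ, one_mul]

theorem passProb_le_one (hW : G.IsIndepSet W) (hB : G.IsIndepSet B) (hρ : IsDensity ρ) :
    passProb G W B ρ ≤ 1 := by
  classical
  rw [passProb_eq_sum hW hB]
  refine div_le_one_of_le₀ ?_ (Nat.cast_nonneg _)
  refine sum_expectation_blocksKet_mul_le hρ fun s => ?_
  exact_mod_cast Finset.card_filter_le _ _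

theorem passProb_sub_fidelity_passedState_le (hW : G.IsIndepSet W) (hB : G.IsIndepSet B)
    (hWB : W ∪ B = Finset.univ) (hρ : IsDensity ρ) :
    passProb G W B ρ - fidelity G (passedState G W B ρ) ≤ 1 / (2 * (k : ℝ) + 1) := by
  classical
  have card_pos : (0 : ℝ) < (divisions k).card := by exact_mod_cast card_divisions_pos k
  rw [fidelity_eq_expectation, passProb_eq_sum hW hB, expectation_passedState hW hB, ← sub_div,
    ← Finset.sum_sub_distrib, div_le_iff₀ card_pos]
  simp only [← mul_sub]
  refine sum_expectation_blocksKet_mul_le hρ fun s => ?_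
  have card_sub : ({d ∈ divisions k | Accepts W B s d}.card : ℝ) -
      {d ∈ divisions k | Accepts W B s d ∧ s d.2.2 = 0}.card =
      {d ∈ divisions k | Accepts W B s d ∧ s d.2.2 ≠ 0}.card := by
    rw [sub_eq_iff_eq_add', ← Finset.filter_filter, ← Finset.filter_filter]
    exact_mod_cast (Finset.card_filter_add_card_filter_not _).symm
  rw [card_sub, one_div, le_inv_mul_iff₀ (by positivity)]
  exact_mod_cast card_divisions_accepts_le hWB s

theorem fidelity_resultState (ρ : Matrix (Blocks V k) (Blocks V k) ℂ) :
    fidelity G (resultState G W B ρ) = fidelity G (passedState G W B ρ) / passProb G W B ρ := by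
  rw [fidelity_eq_expectation, fidelity_eq_expectation, resultState, ← Complex.ofReal_inv,
    expectation_ofReal_smul, inv_mul_eq_div]

theorem le_fidelity_resultState (hW : G.IsIndepSet W) (hB : G.IsIndepSet B)
    (hWB : W ∪ B = Finset.univ) (hρ : IsDensity ρ) {α : ℝ} (hα : 0 < α)
    (hp : α ≤ passProb G W B ρ) :
    1 - 1 / (α * (2 * (k : ℝ) + 1)) ≤ fidelity G (resultState G W B ρ) := by
  have passProb_pos : 0 < passProb G W B ρ := hα.trans_le hp
  rw [fidelity_resultState, sub_le_comm]
  calc 1 - fidelity G (passedState G W B ρ) / passProb G W B ρ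
      = (passProb G W B ρ - fidelity G (passedState G W B ρ)) / passProb G W B ρ := by
        rw [sub_div, div_self passProb_pos.ne']
    _ ≤ 1 / (2 * (k : ℝ) + 1) / α := by
        gcongr
        exact passProb_sub_fidelity_passedState_le hW hB hWB hρ
    _ = 1 / (α * (2 * (k : ℝ) + 1)) := by rw [div_div, mul_comm]

theorem significanceLevel_le (hW : G.IsIndepSet W) (hB : G.IsIndepSet B)
    (hWB : W ∪ B = Finset.univ) {α : ℝ} (hα : 0 < α) :
    significanceLevel G W B k (1 - 1 / (α * (2 * (k : ℝ) + 1))) ≤ α := by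
  refine Real.sSup_le ?_ hα.le
  rintro p ⟨ρ, hρ, rfl, -, hlt⟩
  by_contra! hp
  exact hlt.not_ge (le_fidelity_resultState hW hB hWB hρ hα hp.le)

theorem le_significanceLevel (hW : G.IsIndepSet W) (hB : G.IsIndepSet B) (hρ : IsDensity ρ)
    (hp : 0 < passProb G W B ρ) {f : ℝ} (hf : fidelity G (resultState G W B ρ) < f) :
    passProb G W B ρ ≤ significanceLevel G W B k f := by
  refine le_csSup ⟨1, ?_⟩ ⟨ρ, hρ, rfl, hp, hf⟩
  rintro p ⟨ρ', hρ', rfl, -⟩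
  exact passProb_le_one hW hB hρ'

end Test

section Tightness

variable {V : Type*} [Fintype V] [DecidableEq V] {G : SimpleGraph V} [DecidableRel G.Adj] {k : ℕ}
  {W B : Finset V}

theorem expectation_oneWrong (i : Fin (2 * k + 1)) (t : Bits V) (s : Blocks V k) :
    expectation (pureState (oneWrong G (graphKet G t) i)) (blocksKet G s) =
      if s = Pi.single i t then 1 else 0 := by
  rw [oneWrong_graphKet,
    expectation_pureState_of_sum_pureState_eq_one (sum_pureState_blocksKet G)]

theorem isDensity_oneWrong (i : Fin (2 * k + 1)) (t : Bits V) :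
    IsDensity (pureState (oneWrong G (graphKet G t) i)) := by
  refine isDensity_pureState ?_
  rw [oneWrong_graphKet, star_dotProduct_of_sum_pureState_eq_one (sum_pureState_blocksKet G),
    if_pos rfl]

theorem passProb_oneWrong (hW : G.IsIndepSet W) (hB : G.IsIndepSet B) (hW₀ : W.Nonempty)
    (hB₀ : B.Nonempty) (i : Fin (2 * k + 1)) :
    passProb G W B (pureState (oneWrong G (graphKet G 1) i)) = 1 / (2 * (k : ℝ) + 1) := by
  classical
  have card_ne_zero : ({d ∈ divisions k | d.2.2 = i}.card : ℝ) ≠ 0 := by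
    have card_pos := card_divisions_pos k
    rw [← card_divisions_third_eq i] at card_pos
    exact_mod_cast (Nat.pos_of_mul_pos_left card_pos).ne'
  rw [passProb_eq_sum hW hB, ← card_divisions_third_eq i]
  simp only [expectation_oneWrong, ite_mul, one_mul, zero_mul, Finset.sum_ite_eq',
    Finset.mem_univ, if_true, accepts_single_iff hW₀ hB₀]
  push_cast
  rw [div_mul_cancel_right₀ card_ne_zero, one_div]

theorem fidelity_resultState_oneWrong (hW : G.IsIndepSet W) (hB : G.IsIndepSet B)
    (hW₀ : W.Nonempty) (hB₀ : B.Nonempty) (i : Fin (2 * k + 1)) :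
    fidelity G (resultState G W B (pureState (oneWrong G (graphKet G 1) i))) = 0 := by
  classical
  have one_ne_zero : (1 : Bits V) ≠ 0 := fun h =>
    hW₀.elim fun v _ => zero_ne_one (congrFun h v).symm
  have third_ne (d : Division k) :
      ¬(d.2.2 = i ∧ (Pi.single i 1 : Blocks V k) d.2.2 = 0) := by
    rintro ⟨rfl, h⟩
    exact one_ne_zero (by simpa using h)
  rw [fidelity_resultState, fidelity_eq_expectation, expectation_passedState hW hB]
  simp only [expectation_oneWrong, ite_mul, one_mul, zero_mul, Finset.sum_ite_eq',
    Finset.mem_univ, if_true, accepts_single_iff hW₀ hB₀, third_ne, Finset.filter_false,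
    Finset.card_empty, Nat.cast_zero, zero_div]

end Tightness

theorem isIndepSet_of_isBipartiteWith {V : Type*} {G : SimpleGraph V} {s t : Set V}
    (h : G.IsBipartiteWith s t) : G.IsIndepSet s :=
  fun _ hv _ hw _ hvw => h.disjoint.notMem_of_mem_left hw (h.mem_of_mem_adj hv hvw)

end GraphStateTest

end

open GraphStateTest in
theorem theorem1_general {V : Type*} [Fintype V] [DecidableEq V] (G : SimpleGraph V)
    [DecidableRel G.Adj] (W B : Finset V) (hW : G.IsIndepSet W) (hB : G.IsIndepSet B) (k : ℕ) :
    (W ∪ B = Finset.univ → ∀ α : ℝ, 0 < α →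
      significanceLevel G W B k (1 - 1 / (α * (2 * (k : ℝ) + 1))) ≤ α ∧
      ∀ ρ : Matrix (Blocks V k) (Blocks V k) ℂ, IsDensity ρ → α ≤ passProb G W B ρ →
        1 - 1 / (α * (2 * (k : ℝ) + 1)) ≤ fidelity G (resultState G W B ρ)) ∧
    (W.Nonempty → B.Nonempty →
      (∃ ψ : Bits V → ℂ, star ψ ⬝ᵥ ψ = 1 ∧ ∀ i : Fin (2 * k + 1),
        IsDensity (pureState (oneWrong G ψ i)) ∧
        passProb G W B (pureState (oneWrong G ψ i)) = 1 / (2 * (k : ℝ) + 1) ∧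
        fidelity G (resultState G W B (pureState (oneWrong G ψ i))) = 0) ∧
      ∀ f : ℝ, 0 < f → 1 / (2 * (k : ℝ) + 1) ≤ significanceLevel G W B k f) := by
  refine ⟨fun hWB α hα => ⟨significanceLevel_le hW hB hWB hα, fun ρ hρ hp =>
    le_fidelity_resultState hW hB hWB hρ hα hp⟩, fun hW₀ hB₀ => ?_⟩
  have passProb_eq (i) := passProb_oneWrong (k := k) hW hB hW₀ hB₀ i
  have fidelity_eq (i) := fidelity_resultState_oneWrong (k := k) hW hB hW₀ hB₀ i
  refine ⟨⟨graphKet G 1, ?_, fun i => ⟨isDensity_oneWrong i 1, passProb_eq i, fidelity_eq i⟩⟩,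
    fun f hf => ?_⟩
  · simp [star_dotProduct_of_sum_pureState_eq_one (sum_pureState_graphKet G)]
  · rw [← passProb_eq 0]
    refine le_significanceLevel hW hB (isDensity_oneWrong 0 1) ?_ ((fidelity_eq 0).trans_lt hf)
    rw [passProb_eq 0]
    positivity

open GraphStateTest in
theorem theorem1 {V : Type*} [Fintype V] [DecidableEq V] (G : SimpleGraph V) [DecidableRel G.Adj]
    (W B : Finset V) (hG : G.IsBipartiteWith (W : Set V) (B : Set V))
    (hWB : W ∪ B = Finset.univ) (k : ℕ) :
    (∀ α : ℝ, 1 / (2 * (k : ℝ) + 1) < α →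
      significanceLevel G W B k (1 - 1 / (α * (2 * (k : ℝ) + 1))) ≤ α ∧
      ∀ ρ : Matrix (Blocks V k) (Blocks V k) ℂ, IsDensity ρ → α ≤ passProb G W B ρ →
        1 - 1 / (α * (2 * (k : ℝ) + 1)) ≤ fidelity G (resultState G W B ρ)) ∧
    (W.Nonempty → B.Nonempty →
      (∃ ψ : Bits V → ℂ, star ψ ⬝ᵥ ψ = 1 ∧ ∀ i : Fin (2 * k + 1),
        IsDensity (pureState (oneWrong G ψ i)) ∧
        passProb G W B (pureState (oneWrong G ψ i)) = 1 / (2 * (k : ℝ) + 1) ∧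
        fidelity G (resultState G W B (pureState (oneWrong G ψ i))) = 0) ∧
      ∀ f : ℝ, 0 < f → 1 / (2 * (k : ℝ) + 1) ≤ significanceLevel G W B k f) := by
  obtain ⟨bound, tight⟩ := theorem1_general G W B (isIndepSet_of_isBipartiteWith hG)
    (isIndepSet_of_isBipartiteWith hG.symm) k
  exact ⟨fun α hα => bound hWB α (lt_trans (by positivity) hα), tight⟩
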